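/- **Definitions.** A *labeled directed graph* $G(V,E)$ consists of a set $V$ of vertices and a set $E$ of edges $e=(s(e),l(e),t(e))$ (start, label, end) with $s(e),t(e)\in V$. A *directed walk* is a sequence $(v_1,e_1,v_2,\dots,e_s,v_{s+1})$, $s\ge 1$, with $v_i\in V$, $e_i\in E$, $s(e_i)=v_i$, $t(e_i)=v_{i+1}$; it is *closed* if $v_1=v_{s+1}$, and it *induces* the subgraph with vertex set $\{v_i\}$ and edge set $\{e_i\}$. A graph is *self-contained* if all its edges are labeled by its own vertices. A set $W\subseteq V$ has the *ideal-graph-property* if no edge points from a vertex in $W$ to a vertex in $V\setminus W$. For subspaces $A,B$ of a Lie algebra, $[A,B]$ is the span of all $[a,b]$, $a\in A$, $b\in B$. Let $(\mathcal M,\delta)$ be an abelian magma, i.e. a (possibly empty) set with a commutative binary operation. An *$\mathcal M$-magma gradation* of $\mathfrak g$ is a direct sum decomposition $\mathfrak g=\bigoplus_{j\in\mathcal M}\mathfrak g_j$ into nonzero subspaces with $[\mathfrak g_j,\mathfrak g_k]\subseteq\mathfrak g_{\delta(j,k)}$ for all $j,k$. Its graph $G_{\mathfrak g}(V,E)$ has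 $V=\{\mathfrak g_j\}_{j\in\mathcal M}$ and one edge $(\mathfrak g_j,\mathfrak g_k,\mathfrak g_{\delta(j,k)})$ for each ordered pair $(j,k)$ with $[\mathfrak g_j,\mathfrak g_k]\ne\{0\}$. The *derived graphs* $\mathcal D^\ell G$ are defined by $\mathcal D^0G=G$ and: $\mathcal D^{\ell+1}G$ is obtained from $\mathcal D^{\ell}G$ by simultaneously deleting all vertices that are not the end of an edge of $\mathcal D^\ell G$, together with all edges in which a deleted vertex occurs as start, label or end. The *lower central graphs* $\mathcal C^\ell G=(\mathcal C^\ell V,\mathcal C^\ell E)$ are defined, with auxiliary edge sets $E_{\mathrm r}^{(\ell)}$, by $\mathcal C^0G=G$, $E_{\mathrm r}^{(0)}=\emptyset$, and: $\mathcal C^{\ell+1}V$ is the set of those $v\in\mathcal C^\ell V$ that are the end of an edge in $\mathcal C^\ell E\cup E_{\mathrm r}^{(\ell)}$; $\mathcal C^{\ell+1}E$ is the set of edges in $\mathcal C^\ell E$ with start, label and end in $\mathcal C^{\ell+1}V$; and $E_{\mathrm r}^{(\ell+1)}$ consists of the edges of $E_{\mathrm r}^{(\ell)}$ with start and end in $\mathcal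 C^{\ell+1}V$ and the edges of $\mathcal C^\ell E$ with start and end in $\mathcal C^{\ell+1}V$ but label not in $\mathcal C^{\ell+1}V$. **Proposition.** Let $\mathfrak g$ be a real Lie algebra with $\dim\mathfrak g\le 4$. Then there exist an abelian magma $(\mathcal M,\delta)$ and an $\mathcal M$-magma gradation of $\mathfrak g$ whose graph $G_{\mathfrak g}(V,E)$ satisfies all of the following. 1. **Solvability.** $\mathfrak g$ is non-solvable if and only if $G_{\mathfrak g}(V,E)$ contains a self-contained subgraph induced by a closed directed walk. 2. **Derived series.** For every $\ell\ge 0$, the direct sum of the subspaces that are vertices of $\mathcal D^\ell G_{\mathfrak g}$ is the derived algebra $\mathcal D^\ell\mathfrak g$ (where $\mathcal D^0\mathfrak g=\mathfrak g$, $\mathcal D^{\ell+1}\mathfrak g=[\mathcal D^\ell\mathfrak g,\mathcal D^\ell\mathfrak g]$). 3. **Nilpotency.** $\mathfrak g$ is nilpotent if and only if $G_{\mathfrak g}(V,E)$ contains no closed directed walk. 4. **Lower central series.** For every $\ell\ge 0$, the direct sum of the subspaces that are vertices of $\mathcal C^\ell G_{\mathfrak g}$ is the term $\mathcal C^\ell\mathfrak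 g$ of the lower central series (where $\mathcal C^0\mathfrak g=\mathfrak g$, $\mathcal C^{\ell+1}\mathfrak g=[\mathfrak g,\mathcal C^\ell\mathfrak g]$). 5. **Ideals.** If $W\subseteq V$ has the ideal-graph-property, then the direct sum of the subspaces in $W$ is an ideal of $\mathfrak g$. 6. **Simplicity.** If $\mathfrak g$ is simple, then there is a closed directed walk that induces a subgraph with vertex set $V$. 7. **Semisimplicity.** If $\mathfrak g$ is semisimple (i.e. its radical is zero), then every vertex lies on a closed directed walk that induces a self-contained subgraph. -/

import Mathlib

namespace LieGraph

/-! ### Labeled directed graphs -/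

/-- A labeled directed edge: starting vertex, labeling vertex, ending vertex. -/
@[ext]
structure LabeledEdge (α : Type*) where
  src : α
  lab : α
  tgt : α

/-- A labeled directed graph: a set of vertices and a set of edges that start and end at vertices.
The label of an edge is not required to be a vertex of the graph, because subgraphs induced by walks
are again graphs, and whether their labels are among their vertices is the notion
`LabeledDigraph.SelfContained`. -/
@[ext]
structure LabeledDigraph (α : Type*) where
  V : Set α
  E : Set (LabeledEdge α)
  src_mem : ∀ e ∈ E, e.src ∈ V
  tgt_mem : ∀ e ∈ E, e.tgt ∈ V

namespace LabeledDigraph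

variable {α : Type*}

/-- Every edge of the graph is labeled by a vertex of the graph. -/
def SelfContained (G : LabeledDigraph α) : Prop :=
  ∀ e ∈ G.E, e.lab ∈ G.V

/-- A directed walk `(v₀, e₀, v₁, …, e_{s-1}, v_s)` of length `s ≥ 1`. -/
structure DirectedWalk (G : LabeledDigraph α) where
  len : ℕ
  len_pos : 0 < len
  vert : Fin (len + 1) → α
  edge : Fin len → LabeledEdge α
  vert_mem : ∀ i, vert i ∈ G.V
  edge_mem : ∀ i, edge i ∈ G.E
  src_eq : ∀ i : Fin len, (edge i).src = vert i.castSucc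
  tgt_eq : ∀ i : Fin len, (edge i).tgt = vert i.succ

/-- A walk is closed if it ends where it starts. -/
def DirectedWalk.IsClosed {G : LabeledDigraph α} (W : G.DirectedWalk) : Prop :=
  W.vert 0 = W.vert (Fin.last W.len)

/-- The subgraph induced by a walk: precisely the vertices and the edges that the walk visits. -/
def DirectedWalk.induced {G : LabeledDigraph α} (W : G.DirectedWalk) : LabeledDigraph α where
  V := Set.range W.vert
  E := Set.range W.edge
  src_mem := by
    rintro _ ⟨i, rfl⟩
    exact ⟨i.castSucc, (W.src_eq i).symm⟩
  tgt_mem := by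
    rintro _ ⟨i, rfl⟩
    exact ⟨i.succ, (W.tgt_eq i).symm⟩

/-- The ideal-graph-property of a set `W` of vertices: no edge points from a vertex in `W` to a
vertex outside `W`. -/
def IdealGraphProperty (G : LabeledDigraph α) (W : Set α) : Prop :=
  W ⊆ G.V ∧ ¬ ∃ e ∈ G.E, e.src ∈ W ∧ e.tgt ∈ G.V \ W

/-- The vertices that are the end of at least one edge from `F`. -/
def targeted (G : LabeledDigraph α) (F : Set (LabeledEdge α)) : Set α :=
  {v ∈ G.V | ∃ e ∈ F, e.tgt = v}

/-- The edges of `G` whose start, label and end all belong to `U`. -/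
def edgesWithin (G : LabeledDigraph α) (U : Set α) : Set (LabeledEdge α) :=
  {e ∈ G.E | e.src ∈ U ∧ e.lab ∈ U ∧ e.tgt ∈ U}

/-- One round of pruning for the derived series: delete all vertices without incoming edge, and
every edge that starts at, is labeled by, or ends at a deleted vertex. -/
def derivedStep (G : LabeledDigraph α) : LabeledDigraph α where
  V := G.targeted G.E
  E := G.edgesWithin (G.targeted G.E)
  src_mem := fun _ he => he.2.1
  tgt_mem := fun _ he => he.2.2.2

/-- The `ℓ`-th derived graph `𝒟^ℓ G`. -/
def derivedGraph (G : LabeledDigraph α) (ℓ : ℕ) : LabeledDigraph α :=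
  derivedStep^[ℓ] G

end LabeledDigraph

/-- A labeled directed graph together with an auxiliary set `Er` of labeled directed edges. -/
@[ext]
structure ExtendedDigraph (α : Type*) extends LabeledDigraph α where
  Er : Set (LabeledEdge α)

namespace ExtendedDigraph

variable {α : Type*}

/-- One round of pruning for the lower central series. Delete all vertices that are not the end of
an edge in `E ∪ Er`. Auxiliary edges survive if their start and end survive. Edges in `E` survive if
their start, label and end survive; those of which start and end survive but the label is deleted
become auxiliary. -/
def lowerCentralStep (G : ExtendedDigraph α) : ExtendedDigraph α where
  V := G.targeted (G.E ∪ G.Er)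
  E := G.edgesWithin (G.targeted (G.E ∪ G.Er))
  src_mem := fun _ he => he.2.1
  tgt_mem := fun _ he => he.2.2.2
  Er :=
    {e ∈ G.Er | e.src ∈ G.targeted (G.E ∪ G.Er) ∧ e.tgt ∈ G.targeted (G.E ∪ G.Er)} ∪
      {e ∈ G.E | e.src ∈ G.targeted (G.E ∪ G.Er) ∧ e.tgt ∈ G.targeted (G.E ∪ G.Er) ∧
        e.lab ∉ G.targeted (G.E ∪ G.Er)}

end ExtendedDigraph

/-- The `ℓ`-th graph `𝒞^ℓ G` of the lower central series; the auxiliary edge set is empty at the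
start, and is dropped from the result. -/
def LabeledDigraph.lowerCentralGraph {α : Type*} (G : LabeledDigraph α) (ℓ : ℕ) :
    LabeledDigraph α :=
  (ExtendedDigraph.lowerCentralStep^[ℓ] { G with Er := ∅ }).toLabeledDigraph

/-! ### Gradings of real Lie algebras by abelian magmas -/

section Grading

variable {L : Type*} [LieRing L] [LieAlgebra ℝ L]

/-- `[A, B]`, the linear span of all brackets `⁅x, y⁆` with `x ∈ A` and `y ∈ B`. -/
def bracketSpan (A B : Submodule ℝ L) : Submodule ℝ L :=
  Submodule.span ℝ {z | ∃ x ∈ A, ∃ y ∈ B, ⁅x, y⁆ = z}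

variable (M : Type*) [CommMagma M] (L)

/-- A gradation of a real Lie algebra by an abelian magma `M`: a decomposition as an internal direct
sum of nonzero subspaces `𝔤_j`, `j ∈ M`, with `[𝔤_j, 𝔤_k] ⊆ 𝔤_{j * k}`. -/
structure MagmaGrading where
  comp : M → Submodule ℝ L
  independent : iSupIndep comp
  iSup_eq_top : ⨆ j, comp j = ⊤
  comp_ne_bot : ∀ j, comp j ≠ ⊥
  bracket_le : ∀ j k, bracketSpan (comp j) (comp k) ≤ comp (j * k)

variable {M L}

/-- The graph of a magma gradation. The vertices are the subspaces `𝔤_j`. Every pair `(j, k)` with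
`[𝔤_j, 𝔤_k] ≠ 0` gives an edge from `𝔤_j` to `𝔤_{j * k}` labeled by `𝔤_k` (and then the pair `(k, j)`
gives an edge from `𝔤_k` to `𝔤_{j * k}` labeled by `𝔤_j`). -/
def MagmaGrading.graph (𝒢 : MagmaGrading L M) : LabeledDigraph (Submodule ℝ L) where
  V := Set.range 𝒢.comp
  E := {e | ∃ j k : M, bracketSpan (𝒢.comp j) (𝒢.comp k) ≠ ⊥ ∧
    e = ⟨𝒢.comp j, 𝒢.comp k, 𝒢.comp (j * k)⟩}
  src_mem := by
    rintro _ ⟨j, k, -, rfl⟩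
    exact ⟨j, rfl⟩
  tgt_mem := by
    rintro _ ⟨j, k, -, rfl⟩
    exact ⟨j * k, rfl⟩

end Grading

end LieGraph

/-!
The properties asked of the graph follow from a condition on the gradation alone, called saturation
here (`MagmaGrading.IsSaturated`): a component at the end of an edge consists of brackets, and edges
that start inside the derived algebra exhaust their ends. Saturation lets the two prunings of the
graph follow the derived and the lower central series step by step
(`IsSaturated.sSup_derivedGraph`, `IsSaturated.sSup_lowerCentralGraph`). Closed walks survive every
pruning for the lower central series, and a finite graph without closed walks is pruned to nothing,
which gives the criterion for nilpotency; closed self-contained walks survive every pruning for the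
derived series. The ideal property holds for every gradation.

So it suffices to find saturated gradations, and for this no classification of the algebras of
dimension at most four is needed. Write `D = [L, L]`.

* If `D = 0` or `D = L`, a single component `L` is enough. By Cartan's criterion this covers all
  algebras with trivial radical, in particular the simple ones, whose graph is then one vertex with
  a self-labeled loop.
* If `D` is abelian or perfect and `[L, D]` is `0` or `D`, then `D` and any complement of it form a
  saturated gradation. This covers the remaining nonsolvable algebras: there `D` is perfect of
  dimension three.
* If `0 < [L, D] < D`, a count of dimensions shows that `D` is the sum of two lines, `[L, D]` and
  `[T, T]` for a complement `T` of `D` (`exists_complement_with_bracket_line`); these three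
  subspaces form a saturated gradation.
* If `D` is neither abelian nor perfect, then `dim L = 4` and `D` is a Heisenberg algebra
  (`finrank_derived_derived`); a line `T` complementary to `D` acts on `D` and leaves a complement
  `P` of the centre `E` of `D` invariant (`exists_invariant_complement`), and `T`, `P`, `E` form a
  saturated gradation. The components are not lines in general, since the action on `P` may have
  nonreal eigenvalues.
-/

namespace LieGraph

-- Makes `Module.End ℝ L` a Lie ring, so that `LieModule.toEnd` can be used.
attribute [local instance] LieRing.ofAssociativeRing

/-! ### Closed walks and the two prunings of a graph -/

namespace LabeledDigraph

variable {α : Type*} {G : LabeledDigraph α}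

/-- The closed walk of length one that runs along a loop. -/
def loopWalk (e : LabeledEdge α) (he : e ∈ G.E) (hloop : e.src = e.tgt) : G.DirectedWalk where
  len := 1
  len_pos := one_pos
  vert _ := e.src
  edge _ := e
  vert_mem _ := G.src_mem e he
  edge_mem _ := he
  src_eq _ := rfl
  tgt_eq _ := hloop.symm

lemma loopWalk_isClosed (e : LabeledEdge α) (he : e ∈ G.E) (hloop : e.src = e.tgt) :
    (loopWalk e he hloop).IsClosed := rfl

lemma loopWalk_induced_V (e : LabeledEdge α) (he : e ∈ G.E) (hloop : e.src = e.tgt) :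
    (loopWalk e he hloop).induced.V = {e.src} :=
  Set.range_const

lemma loopWalk_induced_selfContained (e : LabeledEdge α) (he : e ∈ G.E) (hloop : e.src = e.tgt)
    (hlab : e.lab = e.src) : (loopWalk e he hloop).induced.SelfContained := by
  rintro _ ⟨i, rfl⟩
  exact ⟨0, hlab.symm⟩

/-- On a closed walk every vertex, including the first one, is the end of an edge of the walk. -/
lemma DirectedWalk.IsClosed.exists_edge_tgt {W : G.DirectedWalk} (hW : W.IsClosed)
    (i : Fin (W.len + 1)) : ∃ j, (W.edge j).tgt = W.vert i := by
  induction i using Fin.cases with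
  | zero =>
    refine ⟨⟨W.len - 1, Nat.sub_lt W.len_pos one_pos⟩, ?_⟩
    rw [W.tgt_eq, hW]
    congr 1
    ext
    simpa using Nat.sub_add_cancel W.len_pos
  | succ j => exact ⟨j, W.tgt_eq j⟩

/-- In a nonempty finite set of vertices each of which has a predecessor in the set, walking
backwards never gets stuck, hence must run into a closed walk. -/
lemma exists_closed_walk {U : Set α} (hfin : U.Finite) (hne : U.Nonempty) (hU : U ⊆ G.V)
    (hpred : ∀ v ∈ U, ∃ e ∈ G.E, e.src ∈ U ∧ e.tgt = v) :
    ∃ W : G.DirectedWalk, W.IsClosed := by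
  obtain ⟨v, hv⟩ := hne
  have : Nonempty (LabeledEdge α) := ⟨⟨v, v, v⟩⟩
  choose! e heE hsrc htgt using hpred
  let p : α → α := fun v => (e v).src
  have hit : ∀ n, p^[n] v ∈ U := by
    intro n
    induction n with
    | zero => exact hv
    | succ n ih => rw [Function.iterate_succ_apply']; exact hsrc _ ih
  obtain ⟨a, b, hab, heq⟩ : ∃ a b, a < b ∧ p^[a] v = p^[b] v := by
    have := hfin.to_subtype
    obtain ⟨a, b, hne, h⟩ :=
      Finite.exists_ne_map_eq_of_infinite fun n : ℕ => (⟨p^[n] v, hit n⟩ : U)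
    have h' : p^[a] v = p^[b] v := congrArg Subtype.val h
    rcases hne.lt_or_gt with h₁ | h₁
    · exact ⟨a, b, h₁, h'⟩
    · exact ⟨b, a, h₁, h'.symm⟩
  -- The predecessors are listed from `p^[b] v` down to `p^[a] v`, so that edges point forwards.
  refine ⟨{ len := b - a
            len_pos := Nat.sub_pos_of_lt hab
            vert := fun i => p^[b - i] v
            edge := fun i => e (p^[b - (i + 1)] v)
            vert_mem := fun i => hU (hit _)
            edge_mem := fun i => heE _ (hit _)
            src_eq := fun i => ?_
            tgt_eq := fun i => htgt _ (hit _) }, ?_⟩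
  · have hi : b - (i : ℕ) = b - (i + 1) + 1 := by have := i.2; omega
    simp only [Fin.val_castSucc, hi, Function.iterate_succ_apply']
    rfl
  · have hba : b - (b - a) = a := by omega
    simp only [DirectedWalk.IsClosed, Fin.val_zero, Fin.val_last, hba, Nat.sub_zero]
    exact heq.symm

lemma derivedGraph_succ (ℓ : ℕ) :
    G.derivedGraph (ℓ + 1) = (G.derivedGraph ℓ).derivedStep :=
  Function.iterate_succ_apply' _ _ _

lemma derivedGraph_E (hG : G.SelfContained) (ℓ : ℕ) :
    (G.derivedGraph ℓ).E = G.edgesWithin (G.derivedGraph ℓ).V := by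
  induction ℓ with
  | zero =>
    ext e
    exact ⟨fun he => ⟨he, G.src_mem e he, hG e he, G.tgt_mem e he⟩, fun he => he.1⟩
  | succ ℓ ih =>
    rw [derivedGraph_succ]
    ext e
    simp only [derivedStep, edgesWithin, ih, Set.mem_ofPred_eq]
    constructor
    · rintro ⟨h, h'⟩
      exact ⟨h.1, h'⟩
    · rintro ⟨h, h₁, h₂, h₃⟩
      exact ⟨⟨h, h₁.1, h₂.1, h₃.1⟩, h₁, h₂, h₃⟩

lemma derivedGraph_V_antitone : Antitone fun ℓ => (G.derivedGraph ℓ).V :=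
  antitone_nat_of_succ_le fun ℓ => by
    rw [derivedGraph_succ]
    exact fun _ hv => hv.1

/-- The vertices of the next derived graph, read off from the edges of the original graph. -/
lemma mem_derivedGraph_succ (hG : G.SelfContained) (ℓ : ℕ) (v : α) :
    v ∈ (G.derivedGraph (ℓ + 1)).V ↔ ∃ e ∈ G.E, e.src ∈ (G.derivedGraph ℓ).V ∧
      e.lab ∈ (G.derivedGraph ℓ).V ∧ e.tgt = v := by
  induction ℓ generalizing v with
  | zero =>
    rw [derivedGraph_succ]
    constructor
    · rintro ⟨-, e, he, rfl⟩
      exact ⟨e, he, G.src_mem e he, hG e he, rfl⟩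
    · rintro ⟨e, he, -, -, rfl⟩
      exact ⟨G.tgt_mem e he, e, he, rfl⟩
  | succ ℓ ih =>
    rw [derivedGraph_succ (ℓ := ℓ + 1)]
    constructor
    · rintro ⟨-, e, he, rfl⟩
      rw [derivedGraph_E hG] at he
      exact ⟨e, he.1, he.2.1, he.2.2.1, rfl⟩
    · rintro ⟨e, he, h₁, h₂, rfl⟩
      have h₃ : e.tgt ∈ (G.derivedGraph (ℓ + 1)).V :=
        (ih _).2 ⟨e, he, derivedGraph_V_antitone ℓ.le_succ h₁,
          derivedGraph_V_antitone ℓ.le_succ h₂, rfl⟩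
      refine ⟨h₃, e, ?_, rfl⟩
      rw [derivedGraph_E hG]
      exact ⟨he, h₁, h₂, h₃⟩

/-- The pruning for the lower central series together with its auxiliary edges. -/
def lowerCentralExt (G : LabeledDigraph α) (ℓ : ℕ) : ExtendedDigraph α :=
  ExtendedDigraph.lowerCentralStep^[ℓ] { G with Er := ∅ }

lemma lowerCentralExt_succ (ℓ : ℕ) :
    G.lowerCentralExt (ℓ + 1) = (G.lowerCentralExt ℓ).lowerCentralStep :=
  Function.iterate_succ_apply' _ _ _

/-- The auxiliary edges are there to make this true: only the ends of an edge decide whether it is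
still available, its label does not matter. -/
lemma mem_lowerCentralExt_edges (ℓ : ℕ) (e : LabeledEdge α) :
    e ∈ (G.lowerCentralExt ℓ).E ∪ (G.lowerCentralExt ℓ).Er ↔
      e ∈ G.E ∧ e.src ∈ (G.lowerCentralGraph ℓ).V ∧ e.tgt ∈ (G.lowerCentralGraph ℓ).V := by
  change _ ↔ e ∈ G.E ∧ e.src ∈ (G.lowerCentralExt ℓ).V ∧ e.tgt ∈ (G.lowerCentralExt ℓ).V
  induction ℓ with
  | zero =>
    constructor
    · rintro (h | h)
      · exact ⟨h, G.src_mem e h, G.tgt_mem e h⟩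
      · exact h.elim
    · exact fun h => Or.inl h.1
  | succ ℓ ih =>
    rw [lowerCentralExt_succ]
    have hsub : ∀ v ∈ (G.lowerCentralExt ℓ).lowerCentralStep.V, v ∈ (G.lowerCentralExt ℓ).V :=
      fun v hv => hv.1
    constructor
    · rintro (h | h | h)
      · exact ⟨(ih.1 (Or.inl h.1)).1, h.2.1, h.2.2.2⟩
      · exact ⟨(ih.1 (Or.inr h.1)).1, h.2.1, h.2.2⟩
      · exact ⟨(ih.1 (Or.inl h.1)).1, h.2.1, h.2.2.1⟩
    · rintro ⟨h, hs, ht⟩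
      rcases ih.2 ⟨h, hsub _ hs, hsub _ ht⟩ with h' | h'
      · by_cases hl : e.lab ∈ (G.lowerCentralExt ℓ).lowerCentralStep.V
        · exact Or.inl ⟨h', hs, hl, ht⟩
        · exact Or.inr (Or.inr ⟨h', hs, ht, hl⟩)
      · exact Or.inr (Or.inl ⟨h', hs, ht⟩)

lemma mem_lowerCentralGraph_succ_iff_targeted (ℓ : ℕ) (v : α) :
    v ∈ (G.lowerCentralGraph (ℓ + 1)).V ↔ v ∈ (G.lowerCentralGraph ℓ).V ∧
      ∃ e ∈ (G.lowerCentralExt ℓ).E ∪ (G.lowerCentralExt ℓ).Er, e.tgt = v := by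
  change v ∈ (G.lowerCentralExt (ℓ + 1)).V ↔ _
  rw [lowerCentralExt_succ]
  rfl

lemma lowerCentralGraph_V_antitone : Antitone fun ℓ => (G.lowerCentralGraph ℓ).V :=
  antitone_nat_of_succ_le fun ℓ v hv =>
    ((mem_lowerCentralGraph_succ_iff_targeted ℓ v).1 hv).1

/-- The vertices of the next lower central graph, read off from the edges of the original graph. -/
lemma mem_lowerCentralGraph_succ (ℓ : ℕ) (v : α) :
    v ∈ (G.lowerCentralGraph (ℓ + 1)).V ↔
      ∃ e ∈ G.E, e.src ∈ (G.lowerCentralGraph ℓ).V ∧ e.tgt = v := by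
  induction ℓ generalizing v with
  | zero =>
    rw [mem_lowerCentralGraph_succ_iff_targeted]
    constructor
    · rintro ⟨-, e, he, rfl⟩
      have he' := (mem_lowerCentralExt_edges 0 e).1 he
      exact ⟨e, he'.1, he'.2.1, rfl⟩
    · rintro ⟨e, he, -, rfl⟩
      exact ⟨G.tgt_mem e he, e, Or.inl he, rfl⟩
  | succ ℓ ih =>
    rw [mem_lowerCentralGraph_succ_iff_targeted]
    constructor
    · rintro ⟨-, e, he, rfl⟩
      have he' := (mem_lowerCentralExt_edges (ℓ + 1) e).1 he
      exact ⟨e, he'.1, he'.2.1, rfl⟩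
    · rintro ⟨e, he, hs, rfl⟩
      have ht : e.tgt ∈ (G.lowerCentralGraph (ℓ + 1)).V :=
        (ih _).2 ⟨e, he, lowerCentralGraph_V_antitone ℓ.le_succ hs, rfl⟩
      exact ⟨ht, e, (mem_lowerCentralExt_edges (ℓ + 1) e).2 ⟨he, hs, ht⟩, rfl⟩

/-- A closed walk survives every pruning for the lower central series. -/
lemma DirectedWalk.IsClosed.vert_mem_lowerCentralGraph {W : G.DirectedWalk} (hW : W.IsClosed)
    (ℓ : ℕ) (i : Fin (W.len + 1)) : W.vert i ∈ (G.lowerCentralGraph ℓ).V := by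
  induction ℓ generalizing i with
  | zero => exact W.vert_mem i
  | succ ℓ ih =>
    obtain ⟨j, hj⟩ := hW.exists_edge_tgt i
    exact (mem_lowerCentralGraph_succ ℓ _).2 ⟨_, W.edge_mem j, by rw [W.src_eq]; exact ih _, hj⟩

/-- A closed walk whose labels are among its vertices survives every pruning for the derived
series. -/
lemma DirectedWalk.IsClosed.vert_mem_derivedGraph (hG : G.SelfContained) {W : G.DirectedWalk}
    (hW : W.IsClosed) (hself : W.induced.SelfContained) (ℓ : ℕ) (i : Fin (W.len + 1)) :
    W.vert i ∈ (G.derivedGraph ℓ).V := by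
  induction ℓ generalizing i with
  | zero => exact W.vert_mem i
  | succ ℓ ih =>
    obtain ⟨j, hj⟩ := hW.exists_edge_tgt i
    obtain ⟨k, hk⟩ := hself (W.edge j) ⟨j, rfl⟩
    exact (mem_derivedGraph_succ hG ℓ _).2
      ⟨_, W.edge_mem j, by rw [W.src_eq]; exact ih _, by rw [← hk]; exact ih k, hj⟩

/-- In a finite graph without closed walks the pruning for the lower central series removes all
vertices. -/
lemma exists_lowerCentralGraph_V_eq_empty (hfin : G.V.Finite)
    (hG : ¬ ∃ W : G.DirectedWalk, W.IsClosed) : ∃ ℓ, (G.lowerCentralGraph ℓ).V = ∅ := by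
  by_contra! hne
  have hsub : ∀ ℓ, (G.lowerCentralGraph ℓ).V ⊆ G.V := fun ℓ =>
    lowerCentralGraph_V_antitone (Nat.zero_le ℓ)
  -- A vertex set of least cardinality is stable under pruning.
  obtain ⟨ℓ, hℓ⟩ : ∃ ℓ, ∀ m, (G.lowerCentralGraph ℓ).V.ncard ≤ (G.lowerCentralGraph m).V.ncard :=
    ⟨_, fun m => Function.argmin_le (fun ℓ => (G.lowerCentralGraph ℓ).V.ncard) m⟩
  have hstable : (G.lowerCentralGraph (ℓ + 1)).V = (G.lowerCentralGraph ℓ).V :=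
    Set.eq_of_subset_of_ncard_le (lowerCentralGraph_V_antitone ℓ.le_succ) (hℓ _)
      (hfin.subset (hsub ℓ))
  refine hG (exists_closed_walk (hfin.subset (hsub ℓ)) (hne ℓ) (hsub ℓ) fun v hv => ?_)
  rw [← hstable] at hv
  exact (mem_lowerCentralGraph_succ ℓ v).1 hv

end LabeledDigraph

/-! ### Brackets of subspaces -/

section Bracket

variable {L : Type*} [LieRing L] [LieAlgebra ℝ L]

lemma bracketSpan_eq_map₂ (A B : Submodule ℝ L) :
    bracketSpan A B = Submodule.map₂ (LieModule.toEnd ℝ L L).toLinearMap A B := by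
  rw [Submodule.map₂_eq_span_image2]
  rfl

lemma lie_mem_bracketSpan {A B : Submodule ℝ L} {x y : L} (hx : x ∈ A) (hy : y ∈ B) :
    ⁅x, y⁆ ∈ bracketSpan A B :=
  Submodule.subset_span ⟨x, hx, y, hy, rfl⟩

lemma bracketSpan_le {A B C : Submodule ℝ L} :
    bracketSpan A B ≤ C ↔ ∀ x ∈ A, ∀ y ∈ B, ⁅x, y⁆ ∈ C := by
  rw [bracketSpan_eq_map₂, Submodule.map₂_le]
  rfl

lemma bracketSpan_eq_bot_iff {A B : Submodule ℝ L} :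
    bracketSpan A B = ⊥ ↔ ∀ x ∈ A, ∀ y ∈ B, ⁅x, y⁆ = 0 := by
  rw [eq_bot_iff, bracketSpan_le]
  rfl

lemma bracketSpan_mono {A A' B B' : Submodule ℝ L} (hA : A ≤ A') (hB : B ≤ B') :
    bracketSpan A B ≤ bracketSpan A' B' :=
  bracketSpan_le.2 fun _ hx _ hy => lie_mem_bracketSpan (hA hx) (hB hy)

lemma bracketSpan_comm (A B : Submodule ℝ L) : bracketSpan A B = bracketSpan B A := by
  refine le_antisymm ?_ ?_ <;>
  · refine bracketSpan_le.2 fun x hx y hy => ?_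
    rw [← lie_skew]
    exact neg_mem (lie_mem_bracketSpan hy hx)

lemma bracketSpan_sup_left (A B C : Submodule ℝ L) :
    bracketSpan (A ⊔ B) C = bracketSpan A C ⊔ bracketSpan B C := by
  simp only [bracketSpan_eq_map₂, Submodule.map₂_sup_left]

lemma bracketSpan_sup_right (A B C : Submodule ℝ L) :
    bracketSpan A (B ⊔ C) = bracketSpan A B ⊔ bracketSpan A C := by
  simp only [bracketSpan_eq_map₂, Submodule.map₂_sup_right]

lemma bracketSpan_sSup_le {S T : Set (Submodule ℝ L)} {C : Submodule ℝ L}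
    (h : ∀ A ∈ S, ∀ B ∈ T, bracketSpan A B ≤ C) : bracketSpan (sSup S) (sSup T) ≤ C := by
  simp only [sSup_eq_iSup', bracketSpan_eq_map₂, Submodule.map₂_iSup_left,
    Submodule.map₂_iSup_right, iSup_le_iff]
  intro B A
  rw [← bracketSpan_eq_map₂]
  exact h _ A.2 _ B.2

lemma bracketSpan_span_singleton_self (a : L) : bracketSpan (ℝ ∙ a) (ℝ ∙ a) = ⊥ := by
  rw [bracketSpan_eq_bot_iff]
  intro x hx y hy
  obtain ⟨r, rfl⟩ := Submodule.mem_span_singleton.1 hx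
  obtain ⟨s, rfl⟩ := Submodule.mem_span_singleton.1 hy
  simp

lemma mem_bracketSpan_span_singleton {x w : L} {A : Submodule ℝ L} :
    w ∈ bracketSpan (ℝ ∙ x) A ↔ ∃ a ∈ A, ⁅x, a⁆ = w := by
  rw [bracketSpan_eq_map₂, Submodule.map₂_span_singleton_eq_map]
  rfl

lemma toSubmodule_lie (I J : LieIdeal ℝ L) :
    (⁅I, J⁆ : LieIdeal ℝ L).toSubmodule = bracketSpan I.toSubmodule J.toSubmodule :=
  LieSubmodule.lieIdeal_oper_eq_linear_span' _ _

lemma derivedSeries_succ_toSubmodule (ℓ : ℕ) :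
    (LieAlgebra.derivedSeries ℝ L (ℓ + 1)).toSubmodule =
      bracketSpan (LieAlgebra.derivedSeries ℝ L ℓ).toSubmodule
        (LieAlgebra.derivedSeries ℝ L ℓ).toSubmodule := by
  rw [← toSubmodule_lie, LieAlgebra.derivedSeries_def, LieAlgebra.derivedSeries_def,
    LieAlgebra.derivedSeriesOfIdeal_succ]

lemma lowerCentralSeries_succ_toSubmodule (ℓ : ℕ) :
    (LieModule.lowerCentralSeries ℝ L L (ℓ + 1)).toSubmodule =
      bracketSpan ⊤ (LieModule.lowerCentralSeries ℝ L L ℓ).toSubmodule := by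
  rw [LieModule.lowerCentralSeries_succ, toSubmodule_lie]
  rfl

end Bracket

/-! ### The graph of a gradation -/

namespace MagmaGrading

variable {L : Type*} [LieRing L] [LieAlgebra ℝ L] {M : Type*} [CommMagma M]
  (𝒢 : MagmaGrading L M)

lemma graph_selfContained : 𝒢.graph.SelfContained := by
  rintro _ ⟨j, k, -, rfl⟩
  exact ⟨k, rfl⟩

lemma edge_mem_graph {j k : M} (h : bracketSpan (𝒢.comp j) (𝒢.comp k) ≠ ⊥) :
    (⟨𝒢.comp j, 𝒢.comp k, 𝒢.comp (j * k)⟩ : LabeledEdge (Submodule ℝ L)) ∈ 𝒢.graph.E :=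
  ⟨j, k, h, rfl⟩

lemma sSup_graph_V : sSup 𝒢.graph.V = ⊤ :=
  (sSup_range (f := 𝒢.comp)).trans 𝒢.iSup_eq_top

/-- A set of vertices with the ideal-graph-property spans an ideal; this holds for every
gradation, because a pair of components without an edge has bracket zero. -/
lemma exists_lieIdeal_of_idealGraphProperty {W : Set (Submodule ℝ L)}
    (hW : 𝒢.graph.IdealGraphProperty W) : ∃ I : LieIdeal ℝ L, I.toSubmodule = sSup W := by
  have key : bracketSpan (sSup W) (sSup 𝒢.graph.V) ≤ sSup W := by
    refine bracketSpan_sSup_le fun A hA B hB => ?_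
    obtain ⟨j, rfl⟩ := hW.1 hA
    obtain ⟨k, rfl⟩ := hB
    by_cases hjk : bracketSpan (𝒢.comp j) (𝒢.comp k) = ⊥
    · exact hjk.le.trans bot_le
    · refine (𝒢.bracket_le j k).trans (le_sSup ?_)
      by_contra hnot
      exact hW.2 ⟨_, 𝒢.edge_mem_graph hjk, hA, ⟨_, rfl⟩, hnot⟩
  rw [sSup_graph_V, bracketSpan_comm] at key
  exact ⟨{ toSubmodule := sSup W
           lie_mem := fun hm => key (lie_mem_bracketSpan Submodule.mem_top hm) }, rfl⟩

/-- A gradation is saturated if its edges see whole components: a component at the end of an edge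
lies in the derived algebra; if the start of the edge lies in the derived algebra, the end consists
of brackets with the start; if the label does so too, the end consists of brackets of the start with
the label. Gradations into lines are saturated. -/
structure IsSaturated : Prop where
  le_derived : ∀ j k, bracketSpan (𝒢.comp j) (𝒢.comp k) ≠ ⊥ → 𝒢.comp (j * k) ≤ bracketSpan ⊤ ⊤
  le_bracketSpan_top : ∀ j k, 𝒢.comp j ≤ bracketSpan ⊤ ⊤ →
    bracketSpan (𝒢.comp j) (𝒢.comp k) ≠ ⊥ → 𝒢.comp (j * k) ≤ bracketSpan (𝒢.comp j) ⊤
  le_bracketSpan : ∀ j k, 𝒢.comp j ≤ bracketSpan ⊤ ⊤ → 𝒢.comp k ≤ bracketSpan ⊤ ⊤ →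
    bracketSpan (𝒢.comp j) (𝒢.comp k) ≠ ⊥ → 𝒢.comp (j * k) ≤ bracketSpan (𝒢.comp j) (𝒢.comp k)

namespace IsSaturated

variable {𝒢}

/-- The graph of a saturated gradation computes the derived series. -/
lemma sSup_derivedGraph (h𝒢 : 𝒢.IsSaturated) (ℓ : ℕ) :
    sSup (𝒢.graph.derivedGraph ℓ).V = (LieAlgebra.derivedSeries ℝ L ℓ).toSubmodule := by
  induction ℓ with
  | zero => exact 𝒢.sSup_graph_V
  | succ ℓ ih =>
    have hmem := LabeledDigraph.mem_derivedGraph_succ 𝒢.graph_selfContained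
    rw [derivedSeries_succ_toSubmodule]
    refine le_antisymm (sSup_le fun v hv => ?_) ?_
    · obtain ⟨_, ⟨j, k, hjk, rfl⟩, hj, hk, rfl⟩ := (hmem ℓ v).1 hv
      cases ℓ with
      | zero => exact h𝒢.le_derived j k hjk
      | succ ℓ =>
        have hle : ∀ v ∈ (𝒢.graph.derivedGraph (ℓ + 1)).V, v ≤ bracketSpan ⊤ ⊤ := by
          intro v hv
          obtain ⟨_, ⟨j, k, hjk, rfl⟩, -, -, rfl⟩ := (hmem ℓ v).1 hv
          exact h𝒢.le_derived j k hjk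
        refine (h𝒢.le_bracketSpan j k (hle _ hj) (hle _ hk) hjk).trans ?_
        rw [← ih]
        exact bracketSpan_mono (le_sSup hj) (le_sSup hk)
    · rw [← ih]
      refine bracketSpan_sSup_le fun A hA B hB => ?_
      obtain ⟨j, rfl⟩ := LabeledDigraph.derivedGraph_V_antitone (Nat.zero_le ℓ) hA
      obtain ⟨k, rfl⟩ := LabeledDigraph.derivedGraph_V_antitone (Nat.zero_le ℓ) hB
      by_cases hjk : bracketSpan (𝒢.comp j) (𝒢.comp k) = ⊥
      · exact hjk.le.trans bot_le
      · exact (𝒢.bracket_le j k).trans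
          (le_sSup ((hmem ℓ _).2 ⟨_, 𝒢.edge_mem_graph hjk, hA, hB, rfl⟩))

/-- The graph of a saturated gradation computes the lower central series. -/
lemma sSup_lowerCentralGraph (h𝒢 : 𝒢.IsSaturated) (ℓ : ℕ) :
    sSup (𝒢.graph.lowerCentralGraph ℓ).V =
      (LieModule.lowerCentralSeries ℝ L L ℓ).toSubmodule := by
  induction ℓ with
  | zero => exact 𝒢.sSup_graph_V
  | succ ℓ ih =>
    have hmem := LabeledDigraph.mem_lowerCentralGraph_succ (G := 𝒢.graph)
    rw [lowerCentralSeries_succ_toSubmodule, bracketSpan_comm]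
    refine le_antisymm (sSup_le fun v hv => ?_) ?_
    · obtain ⟨_, ⟨j, k, hjk, rfl⟩, hj, rfl⟩ := (hmem ℓ v).1 hv
      cases ℓ with
      | zero => exact h𝒢.le_derived j k hjk
      | succ ℓ =>
        have hle : 𝒢.comp j ≤ bracketSpan ⊤ ⊤ := by
          obtain ⟨_, ⟨a, b, hab, rfl⟩, -, h⟩ := (hmem ℓ _).1 hj
          exact h.symm.le.trans (h𝒢.le_derived a b hab)
        refine (h𝒢.le_bracketSpan_top j k hle hjk).trans ?_
        rw [← ih]
        exact bracketSpan_mono (le_sSup hj) le_rfl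
    · rw [← ih, ← 𝒢.sSup_graph_V]
      refine bracketSpan_sSup_le fun A hA B hB => ?_
      obtain ⟨j, rfl⟩ := LabeledDigraph.lowerCentralGraph_V_antitone (Nat.zero_le ℓ) hA
      obtain ⟨k, rfl⟩ := hB
      by_cases hjk : bracketSpan (𝒢.comp j) (𝒢.comp k) = ⊥
      · exact hjk.le.trans bot_le
      · exact (𝒢.bracket_le j k).trans
          (le_sSup ((hmem ℓ _).2 ⟨_, 𝒢.edge_mem_graph hjk, hA, rfl⟩))

/-- A closed self-contained walk survives in all derived graphs, so the derived series cannot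
reach zero. -/
lemma not_isSolvable_of_closed_walk (h𝒢 : 𝒢.IsSaturated) {W : 𝒢.graph.DirectedWalk}
    (hW : W.IsClosed) (hself : W.induced.SelfContained) : ¬ LieAlgebra.IsSolvable L := by
  intro hsol
  obtain ⟨ℓ, hℓ⟩ := (LieAlgebra.isSolvable_iff ℝ L).1 hsol
  obtain ⟨j, hj⟩ := W.vert_mem 0
  have h := le_sSup (hW.vert_mem_derivedGraph 𝒢.graph_selfContained hself ℓ 0)
  rw [h𝒢.sSup_derivedGraph, hℓ, ← hj] at h
  exact 𝒢.comp_ne_bot j (le_bot_iff.1 h)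

lemma isNilpotent_iff_not_exists_closed_walk [Finite M] (h𝒢 : 𝒢.IsSaturated) :
    LieRing.IsNilpotent L ↔ ¬ ∃ W : 𝒢.graph.DirectedWalk, W.IsClosed := by
  rw [LieRing.IsNilpotent, LieModule.isNilpotent_iff ℝ]
  constructor
  · rintro ⟨ℓ, hℓ⟩ ⟨W, hW⟩
    obtain ⟨j, hj⟩ := W.vert_mem 0
    have h := le_sSup (hW.vert_mem_lowerCentralGraph ℓ 0)
    rw [h𝒢.sSup_lowerCentralGraph, hℓ, ← hj] at h
    exact 𝒢.comp_ne_bot j (le_bot_iff.1 h)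
  · intro h
    obtain ⟨ℓ, hℓ⟩ := LabeledDigraph.exists_lowerCentralGraph_V_eq_empty
      (Set.finite_range 𝒢.comp) h
    refine ⟨ℓ, ?_⟩
    rw [← LieSubmodule.toSubmodule_eq_bot, ← h𝒢.sSup_lowerCentralGraph, hℓ, sSup_empty]

end IsSaturated

end MagmaGrading

/-! ### Brackets of subspaces of small dimension -/

section SmallDimension

open Module

variable {L : Type*} [LieRing L] [LieAlgebra ℝ L] [FiniteDimensional ℝ L]

lemma exists_sup_span_singleton_eq {C A : Submodule ℝ L} (hCA : C ≤ A)
    (hfin : finrank ℝ A ≤ finrank ℝ C + 1) : ∃ a ∈ A, C ⊔ ℝ ∙ a = A := by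
  rcases hCA.eq_or_lt with rfl | hlt
  · exact ⟨0, C.zero_mem, by simp⟩
  · obtain ⟨a, haA, haC⟩ := SetLike.exists_of_lt hlt
    have hle : C ⊔ ℝ ∙ a ≤ A := sup_le hCA ((Submodule.span_singleton_le_iff_mem a A).2 haA)
    have hlt' : C < C ⊔ ℝ ∙ a :=
      lt_of_le_of_ne le_sup_left fun h =>
        haC (h ▸ (le_sup_right : ℝ ∙ a ≤ C ⊔ ℝ ∙ a) (Submodule.mem_span_singleton_self a))
    have := Submodule.finrank_lt_finrank_of_lt hlt'
    exact ⟨a, haA, Submodule.eq_of_le_of_finrank_le hle (by omega)⟩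

/-- Over a subspace `C` of codimension at most one, the only bracket not involving `C` is that of a
vector with itself. -/
lemma bracketSpan_self_le_of_codim_le_one {C A : Submodule ℝ L} (hCA : C ≤ A)
    (hfin : finrank ℝ A ≤ finrank ℝ C + 1) : bracketSpan A A ≤ bracketSpan A C := by
  obtain ⟨a, haA, hA⟩ := exists_sup_span_singleton_eq hCA hfin
  have haA' : ℝ ∙ a ≤ A := (Submodule.span_singleton_le_iff_mem a A).2 haA
  calc bracketSpan A A = bracketSpan A C ⊔ bracketSpan (C ⊔ ℝ ∙ a) (ℝ ∙ a) := by
        rw [hA, ← bracketSpan_sup_right, hA]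
    _ ≤ bracketSpan A C := by
        rw [bracketSpan_sup_left, bracketSpan_span_singleton_self, sup_bot_eq,
          bracketSpan_comm C (ℝ ∙ a)]
        exact sup_le le_rfl (bracketSpan_mono haA' le_rfl)

/-- A subspace with a central subspace of codimension at most one is abelian. -/
lemma bracketSpan_self_eq_bot_of_codim_le_one {C A : Submodule ℝ L} (hCA : C ≤ A)
    (hfin : finrank ℝ A ≤ finrank ℝ C + 1) (hcomm : bracketSpan A C = ⊥) :
    bracketSpan A A = ⊥ :=
  le_bot_iff.1 ((bracketSpan_self_le_of_codim_le_one hCA hfin).trans hcomm.le)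

lemma bracketSpan_self_eq_bot_of_finrank_le_one {A : Submodule ℝ L} (hA : finrank ℝ A ≤ 1) :
    bracketSpan A A = ⊥ := by
  refine bracketSpan_self_eq_bot_of_codim_le_one (C := ⊥) bot_le (by simpa using hA) ?_
  rw [bracketSpan_eq_bot_iff]
  rintro x - y hy
  rw [(Submodule.mem_bot ℝ).1 hy, lie_zero]

lemma finrank_bracketSpan_self_le_one {A : Submodule ℝ L} (hA : finrank ℝ A ≤ 2) :
    finrank ℝ (bracketSpan A A) ≤ 1 := by
  rcases eq_or_ne A ⊥ with rfl | hne
  · rw [bracketSpan_self_eq_bot_of_finrank_le_one] <;> simp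
  obtain ⟨a, haA, ha⟩ := A.exists_mem_ne_zero_of_ne_bot hne
  obtain ⟨b, -, hb⟩ := exists_sup_span_singleton_eq
    ((Submodule.span_singleton_le_iff_mem a A).2 haA) (by rw [finrank_span_singleton ha]; exact hA)
  have hle : bracketSpan (ℝ ∙ a) (ℝ ∙ b) ≤ ℝ ∙ ⁅a, b⁆ := by
    rw [bracketSpan_le]
    intro x hx y hy
    obtain ⟨r, rfl⟩ := Submodule.mem_span_singleton.1 hx
    obtain ⟨s, rfl⟩ := Submodule.mem_span_singleton.1 hy
    simp only [smul_lie, lie_smul]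
    exact Submodule.smul_mem _ _ (Submodule.smul_mem _ _ (Submodule.mem_span_singleton_self _))
  have hle' : bracketSpan A A ≤ ℝ ∙ ⁅a, b⁆ := by
    rw [← hb, bracketSpan_sup_left, bracketSpan_sup_right, bracketSpan_sup_right,
      bracketSpan_span_singleton_self, bracketSpan_span_singleton_self,
      bracketSpan_comm (ℝ ∙ b), bot_sup_eq, sup_bot_eq, sup_idem]
    exact hle
  refine (Submodule.finrank_mono hle').trans ?_
  exact (finrank_span_le_card _).trans (by simp)

/-- A line is exhausted by each of its nonzero subspaces. -/
lemma le_of_finrank_eq_one {A B : Submodule ℝ L} (hB : finrank ℝ B = 1) (hAB : A ≤ B)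
    (hA : A ≠ ⊥) : B ≤ A := by
  refine (Submodule.eq_of_le_of_finrank_le hAB ?_).ge
  rw [hB]
  exact Submodule.one_le_finrank_iff.2 hA

/-- On a one-dimensional ideal the algebra acts through a character, which vanishes on the derived
algebra. -/
lemma bracketSpan_derived_eq_bot_of_finrank_eq_one (I : LieIdeal ℝ L)
    (hI : finrank ℝ I.toSubmodule = 1) : bracketSpan (bracketSpan ⊤ ⊤) I.toSubmodule = ⊥ := by
  obtain ⟨⟨z, hz⟩, -, hspan⟩ := finrank_eq_one_iff'.1 hI
  have hspan' : ∀ w ∈ I, ∃ c : ℝ, c • z = w := fun w hw =>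
    (hspan ⟨w, hw⟩).imp fun c hc => congrArg Subtype.val hc
  have hle : bracketSpan ⊤ ⊤ ≤ LinearMap.ker ((LieModule.toEnd ℝ L L).toLinearMap.flip z) := by
    rw [bracketSpan_le]
    intro x _ y _
    change ⁅⁅x, y⁆, z⁆ = 0
    obtain ⟨c, hc⟩ := hspan' _ (lie_mem_right ℝ L I x z hz)
    obtain ⟨d, hd⟩ := hspan' _ (lie_mem_right ℝ L I y z hz)
    rw [lie_lie, ← hc, ← hd, lie_smul, lie_smul, ← hc, ← hd, smul_comm, sub_self]
  rw [bracketSpan_eq_bot_iff]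
  intro x hx w hw
  obtain ⟨c, rfl⟩ := hspan' w hw
  have hxz : ⁅x, z⁆ = 0 := hle hx
  rw [lie_smul, hxz, smul_zero]

/-- The derived algebra contains no nonabelian ideal of dimension two: its bracket would be a line
that is central in the derived algebra. -/
lemma bracketSpan_self_eq_bot_of_finrank_le_two (I : LieIdeal ℝ L)
    (hI : I.toSubmodule ≤ bracketSpan ⊤ ⊤) (hfin : finrank ℝ I.toSubmodule ≤ 2) :
    bracketSpan I.toSubmodule I.toSubmodule = ⊥ := by
  by_contra hne
  have hone : finrank ℝ (bracketSpan I.toSubmodule I.toSubmodule) = 1 :=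
    le_antisymm (finrank_bracketSpan_self_le_one hfin) (Submodule.one_le_finrank_iff.2 hne)
  refine hne (bracketSpan_self_eq_bot_of_codim_le_one
    (C := bracketSpan I.toSubmodule I.toSubmodule) ?_ (by omega) ?_)
  · rw [← toSubmodule_lie]
    exact LieSubmodule.lie_le_right I I
  · rw [eq_bot_iff, ← toSubmodule_lie,
      ← bracketSpan_derived_eq_bot_of_finrank_eq_one ⁅I, I⁆ (by rw [toSubmodule_lie]; exact hone)]
    exact bracketSpan_mono hI le_rfl

/-- If `[X, Y] = μ Y` with `Y` invertible, then `X - Y X Y⁻¹ = μ` has trace zero. -/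
lemma eq_zero_of_commutator_eq_smul {V : Type*} [AddCommGroup V] [Module ℝ V]
    [FiniteDimensional ℝ V] [Nontrivial V] {X Y : End ℝ V} (hY : IsUnit Y) {μ : ℝ}
    (h : X * Y - Y * X = μ • Y) : μ = 0 := by
  obtain ⟨u, rfl⟩ := hY
  have h' : X - u * (X * ↑u⁻¹) = μ • (1 : End ℝ V) := by
    have := congrArg (· * (↑u⁻¹ : End ℝ V)) h
    simpa [sub_mul, mul_assoc] using this
  have ht := congrArg (LinearMap.trace ℝ V) h'
  rw [map_sub, LinearMap.trace_mul_comm, mul_assoc, Units.inv_mul, mul_one, sub_self, map_smul,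
    LinearMap.trace_one, smul_eq_mul, eq_comm, mul_eq_zero] at ht
  exact ht.resolve_right (Nat.cast_ne_zero.2 finrank_pos.ne')

end SmallDimension

/-! ### The structure of the algebras of dimension at most four -/

section Structure

open Module

variable {L : Type*} [LieRing L] [LieAlgebra ℝ L] [FiniteDimensional ℝ L]

/-- A nonabelian, nonperfect derived algebra of an algebra of dimension at most four has dimension
three and a one-dimensional derived algebra. The alternative of a two-dimensional second derived
algebra `E` is excluded by a trace: some `y = [x, y] / μ` modulo `E` would act bijectively on `E`. -/
lemma finrank_derived_derived (hL : finrank ℝ L ≤ 4) {D : Submodule ℝ L}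
    (hD : D = bracketSpan ⊤ ⊤) (hDtop : D ≠ ⊤) (hne : bracketSpan D D ≠ ⊥)
    (hnp : bracketSpan D D ≠ D) :
    finrank ℝ L = 4 ∧ finrank ℝ D = 3 ∧ finrank ℝ (bracketSpan D D) = 1 := by
  let DI : LieIdeal ℝ L := ⁅(⊤ : LieIdeal ℝ L), (⊤ : LieIdeal ℝ L)⁆
  have hDI : DI.toSubmodule = D := by rw [hD]; exact toSubmodule_lie _ _
  let E : LieIdeal ℝ L := ⁅DI, DI⁆
  have hE : E.toSubmodule = bracketSpan D D := by rw [← hDI]; exact toSubmodule_lie _ _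
  have hED : bracketSpan D D ≤ D := by
    rw [← hE, ← hDI]
    exact LieSubmodule.lie_le_right DI DI
  have hD4 : finrank ℝ D < finrank ℝ L := Submodule.finrank_lt hDtop
  have hE3 : finrank ℝ (bracketSpan D D) < finrank ℝ D :=
    Submodule.finrank_lt_finrank_of_lt (lt_of_le_of_ne hED hnp)
  have hD3 : ¬ finrank ℝ D ≤ 2 := fun h => hne <| by
    simpa only [hDI] using
      bracketSpan_self_eq_bot_of_finrank_le_two DI (by rw [hDI, hD]) (by rw [hDI]; exact h)
  have hE1 : 1 ≤ finrank ℝ (bracketSpan D D) := Submodule.one_le_finrank_iff.2 hne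
  refine ⟨by omega, by omega, le_antisymm (not_lt.1 fun hE2 => ?_) hE1⟩
  have hEab : bracketSpan E.toSubmodule E.toSubmodule = ⊥ :=
    bracketSpan_self_eq_bot_of_finrank_le_two E (by rw [hE, ← hD]; exact hED)
      (by rw [hE]; omega)
  obtain ⟨x, -, hx⟩ := exists_sup_span_singleton_eq (le_top : D ≤ ⊤) (by rw [finrank_top]; omega)
  obtain ⟨y, hyD, hy⟩ := exists_sup_span_singleton_eq (hE.le.trans hED) (by rw [hE]; omega)
  have hxy : ⁅x, y⁆ ∈ E.toSubmodule ⊔ ℝ ∙ y := by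
    rw [hy, hD]
    exact lie_mem_bracketSpan trivial trivial
  obtain ⟨e, he, f, hf, hef⟩ := Submodule.mem_sup.1 hxy
  obtain ⟨μ, rfl⟩ := Submodule.mem_span_singleton.1 hf
  -- `y` acts surjectively on `E`, because `E = [D, D] = [y, E]`.
  have hsurj : E.toSubmodule ≤ bracketSpan (ℝ ∙ y) E.toSubmodule := by
    calc E.toSubmodule = bracketSpan D D := hE
      _ ≤ bracketSpan D E.toSubmodule :=
        bracketSpan_self_le_of_codim_le_one (hE.le.trans hED) (by rw [hE]; omega)
      _ = bracketSpan (ℝ ∙ y) E.toSubmodule := by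
        rw [← hy, bracketSpan_sup_left, hEab, bot_sup_eq]
  have hY : IsUnit (LieModule.toEnd ℝ L E y) := by
    rw [LinearMap.isUnit_iff_range_eq_top, LinearMap.range_eq_top]
    rintro ⟨w, hw⟩
    obtain ⟨v, hv, hvw⟩ := mem_bracketSpan_span_singleton.1 (hsurj hw)
    exact ⟨⟨v, hv⟩, Subtype.ext hvw⟩
  have hcomm : LieModule.toEnd ℝ L E x * LieModule.toEnd ℝ L E y -
      LieModule.toEnd ℝ L E y * LieModule.toEnd ℝ L E x = μ • LieModule.toEnd ℝ L E y := by
    rw [← LieRing.of_associative_ring_bracket, ← LieHom.map_lie, ← hef, map_add, map_smul]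
    have : LieModule.toEnd ℝ L E e = 0 := by
      ext w
      exact bracketSpan_eq_bot_iff.1 hEab e he w w.2
    rw [this, zero_add]
  have : Nontrivial E := by
    have h1 : 0 < finrank ℝ E.toSubmodule := by rw [hE]; exact hE1
    exact Module.nontrivial_of_finrank_pos h1
  have hμ := eq_zero_of_commutator_eq_smul hY hcomm
  -- Hence `[x, y] ∈ E`, and `[L, L]` is contained in `E`.
  rw [hμ, zero_smul, add_zero] at hef
  have hDE : D ≤ E.toSubmodule := by
    calc D = bracketSpan ⊤ ⊤ := hD
      _ ≤ bracketSpan ⊤ D :=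
        bracketSpan_self_le_of_codim_le_one le_top (by rw [finrank_top]; omega)
      _ = bracketSpan D D ⊔ (bracketSpan (ℝ ∙ x) E.toSubmodule ⊔
          bracketSpan (ℝ ∙ x) (ℝ ∙ y)) := by
        rw [← bracketSpan_sup_right, hy, ← bracketSpan_sup_left, hx]
      _ ≤ E.toSubmodule := by
        refine sup_le hE.ge (sup_le ?_ ?_)
        · exact bracketSpan_le.2 fun a _ b hb => lie_mem_right ℝ L E a b hb
        · rw [bracketSpan_le]
          intro a ha b hb
          obtain ⟨r, rfl⟩ := Submodule.mem_span_singleton.1 ha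
          obtain ⟨s, rfl⟩ := Submodule.mem_span_singleton.1 hb
          rw [smul_lie, lie_smul, ← hef]
          exact Submodule.smul_mem _ _ (Submodule.smul_mem _ _ he)
  have := Submodule.finrank_mono hDE
  rw [hE] at this
  omega

/-- If the derived algebra `D` is a Heisenberg algebra with centre `E = [D, D]`, then a complement
`ℝ x` of `D` leaves a complement of `E` in `D` invariant: the image of `D` under `ad x - τ`, where
`τ` is the eigenvalue of `ad x` on `E`. As `[ad x d, d'] = -[d, (ad x - τ) d']` for `d, d' ∈ D`,
surjectivity of `ad x` modulo `E` makes `ad x - τ` injective modulo `E`. -/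
lemma exists_invariant_complement (hL : finrank ℝ L = 4) {D E : Submodule ℝ L}
    (hD : D = bracketSpan ⊤ ⊤) (hE : E = bracketSpan D D)
    (hD3 : finrank ℝ D = 3) (hE1 : finrank ℝ E = 1) :
    ∃ T P : Submodule ℝ L, finrank ℝ T = 1 ∧ P ≠ ⊥ ∧ IsCompl T D ∧ Disjoint P E ∧ P ⊔ E = D ∧
      bracketSpan T P = P ∧ bracketSpan ⊤ E ≤ E := by
  let DI : LieIdeal ℝ L := ⁅(⊤ : LieIdeal ℝ L), (⊤ : LieIdeal ℝ L)⁆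
  have hDI : DI.toSubmodule = D := by rw [hD]; exact toSubmodule_lie _ _
  let EI : LieIdeal ℝ L := ⁅DI, DI⁆
  have hEI : EI.toSubmodule = E := by rw [hE, ← hDI]; exact toSubmodule_lie _ _
  have hED : E ≤ D := by
    rw [← hEI, ← hDI]
    exact LieSubmodule.lie_le_right DI DI
  have hLE : ∀ a : L, ∀ b ∈ E, ⁅a, b⁆ ∈ E := by
    intro a b hb
    rw [← hEI] at hb ⊢
    exact lie_mem_right ℝ L EI a b hb
  have hDE : bracketSpan D E = ⊥ := by
    rw [hD, ← hEI]
    exact bracketSpan_derived_eq_bot_of_finrank_eq_one EI (by rw [hEI]; exact hE1)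
  have hDE' := bracketSpan_eq_bot_iff.1 hDE
  have hLD : ∀ a b : L, ⁅a, b⁆ ∈ D := fun a b => by
    rw [hD]
    exact lie_mem_bracketSpan trivial trivial
  obtain ⟨x, -, hx⟩ := exists_sup_span_singleton_eq (le_top : D ≤ ⊤) (by rw [finrank_top]; omega)
  have hDtop : D ≠ ⊤ := by
    rintro rfl
    rw [finrank_top] at hD3
    omega
  have hxD : x ∉ D := fun h =>
    hDtop (by rwa [sup_eq_left.2 ((Submodule.span_singleton_le_iff_mem x D).2 h)] at hx)
  have hx0 : x ≠ 0 := fun h => hxD (h ▸ D.zero_mem)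
  obtain ⟨τ, hτ⟩ : ∃ τ : ℝ, ∀ z ∈ E, ⁅x, z⁆ = τ • z := by
    obtain ⟨⟨z, hz⟩, -, hspan⟩ := finrank_eq_one_iff'.1 hE1
    obtain ⟨τ, hτ⟩ := hspan ⟨⁅x, z⁆, hLE x z hz⟩
    have hτ' : τ • z = ⁅x, z⁆ := congrArg Subtype.val hτ
    refine ⟨τ, fun w hw => ?_⟩
    obtain ⟨c, hc⟩ := hspan ⟨w, hw⟩
    have hc' : c • z = w := congrArg Subtype.val hc
    rw [← hc', lie_smul, ← hτ', smul_comm]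
  let g : End ℝ L := LieModule.toEnd ℝ L L x - τ • 1
  have hg : ∀ d, g d = ⁅x, d⁆ - τ • d := fun d => rfl
  have hgD : Submodule.map g D ≤ D := by
    rintro _ ⟨d, hd, rfl⟩
    exact D.sub_mem (hLD x d) (D.smul_mem τ hd)
  have hDx : D ≤ bracketSpan (ℝ ∙ x) D ⊔ E := by
    calc D = bracketSpan ⊤ ⊤ := hD
      _ ≤ bracketSpan ⊤ D :=
        bracketSpan_self_le_of_codim_le_one le_top (by rw [finrank_top]; omega)
      _ = bracketSpan (ℝ ∙ x) D ⊔ E := by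
        rw [← hx, bracketSpan_sup_left, sup_comm, hE]
  have hinj : ∀ d ∈ D, g d ∈ E → d ∈ E := by
    intro d hd hgd
    by_contra hdE
    have hcent : ∀ d' ∈ D, ⁅d', d⁆ = 0 := by
      intro d' hd'
      obtain ⟨a, ha, e, he, rfl⟩ := Submodule.mem_sup.1 (hDx hd')
      obtain ⟨b, hb, rfl⟩ := mem_bracketSpan_span_singleton.1 ha
      have hxd : ⁅x, d⁆ = g d + τ • d := by rw [hg, sub_add_cancel]
      have hbd : ⁅b, d⁆ ∈ E := by rw [hE]; exact lie_mem_bracketSpan hb hd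
      rw [add_lie, lie_lie, hτ _ hbd, hxd, lie_add, hDE' b hb _ hgd, lie_smul, zero_add, sub_self,
        zero_add, ← lie_skew, hDE' d hd e he, neg_zero]
    have hlt : E < E ⊔ ℝ ∙ d :=
      lt_of_le_of_ne le_sup_left fun h =>
        hdE (h ▸ (le_sup_right : ℝ ∙ d ≤ E ⊔ ℝ ∙ d) (Submodule.mem_span_singleton_self d))
    have hfin := Submodule.finrank_lt_finrank_of_lt hlt
    have hab : bracketSpan D D = ⊥ := by
      refine bracketSpan_self_eq_bot_of_codim_le_one (C := E ⊔ ℝ ∙ d)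
        (sup_le hED ((Submodule.span_singleton_le_iff_mem d D).2 hd)) (by omega) ?_
      rw [bracketSpan_sup_right, hDE, bot_sup_eq, bracketSpan_eq_bot_iff]
      intro a ha b hb
      obtain ⟨r, rfl⟩ := Submodule.mem_span_singleton.1 hb
      rw [lie_smul, hcent a ha, smul_zero]
    rw [hE, hab, finrank_bot] at hE1
    exact zero_ne_one hE1
  have hdisj : Disjoint (Submodule.map g D) E := by
    rw [Submodule.disjoint_def]
    rintro _ ⟨d, hd, rfl⟩ hgd
    rw [hg, hτ d (hinj d hd hgd), sub_self]
  have hrank : 2 ≤ finrank ℝ (Submodule.map g D) := by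
    have h1 := LinearMap.finrank_range_add_finrank_ker (g.domRestrict D)
    have h2 : finrank ℝ (LinearMap.ker (g.domRestrict D)) ≤ finrank ℝ E := by
      rw [← Submodule.finrank_map_subtype_eq]
      refine Submodule.finrank_mono ?_
      rintro _ ⟨d, hd, rfl⟩
      refine hinj d d.2 ?_
      have : g d = 0 := hd
      exact this ▸ E.zero_mem
    rw [LinearMap.range_domRestrict] at h1
    omega
  have hsup : Submodule.map g D ⊔ E = D := by
    refine Submodule.eq_of_le_of_finrank_le (sup_le hgD hED) ?_
    have h1 := Submodule.finrank_sup_add_finrank_inf_eq (Submodule.map g D) E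
    rw [hdisj.eq_bot, finrank_bot] at h1
    omega
  have hxP : bracketSpan (ℝ ∙ x) (Submodule.map g D) ≤ Submodule.map g D := by
    intro w hw
    obtain ⟨_, ⟨d, hd, rfl⟩, rfl⟩ := mem_bracketSpan_span_singleton.1 hw
    exact ⟨⁅x, d⁆, hLD x d, by simp only [hg, lie_sub, lie_smul]⟩
  refine ⟨ℝ ∙ x, Submodule.map g D, finrank_span_singleton hx0, ?_, ?_, hdisj, hsup,
    le_antisymm hxP ?_, bracketSpan_le.2 fun a _ b hb => hLE a b hb⟩
  · intro h
    rw [h, finrank_bot] at hrank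
    omega
  · refine ⟨((Submodule.disjoint_span_singleton' hx0).2 hxD).symm, ?_⟩
    rw [codisjoint_iff, sup_comm, hx]
  · intro p hp
    have h1 : D ≤ bracketSpan (ℝ ∙ x) (Submodule.map g D) ⊔ E := by
      refine hDx.trans (sup_le ?_ le_sup_right)
      nth_rewrite 1 [← hsup]
      rw [bracketSpan_sup_right]
      exact sup_le_sup le_rfl (bracketSpan_le.2 fun a _ b hb => hLE a b hb)
    obtain ⟨q, hq, e, he, rfl⟩ := Submodule.mem_sup.1 (h1 (hgD hp))
    have he' : e ∈ Submodule.map g D := by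
      simpa using sub_mem hp (hxP hq)
    rw [Submodule.disjoint_def.1 hdisj e he' he, add_zero]
    exact hq

/-- By Cartan's criterion an algebra with trivial radical has nondegenerate Killing form, and then
the orthogonal complement of the derived algebra is an abelian ideal. -/
lemma bracketSpan_top_top_of_hasTrivialRadical [LieAlgebra.HasTrivialRadical ℝ L] :
    bracketSpan (⊤ : Submodule ℝ L) ⊤ = ⊤ := by
  let D : LieIdeal ℝ L := ⁅(⊤ : LieIdeal ℝ L), (⊤ : LieIdeal ℝ L)⁆
  have hD : D.toSubmodule = bracketSpan ⊤ ⊤ := toSubmodule_lie _ _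
  have hcompl := D.isCompl_killingCompl
  have hbot : D.killingCompl = ⊥ := by
    refine (LieAlgebra.hasTrivialRadical_iff_no_abelian_ideals ℝ L).1 ‹_› _ ?_
    rw [LieAlgebra.abelian_iff_derived_one_eq_bot, eq_bot_iff, ← hcompl.inf_eq_bot]
    exact le_inf (LieSubmodule.mono_lie le_top le_top) (LieSubmodule.lie_le_right _ _)
  rw [← hD, LieSubmodule.toSubmodule_eq_top, ← hcompl.sup_eq_top, hbot, sup_bot_eq]

lemma bracketSpan_derived_of_not_isSolvable (hL : finrank ℝ L ≤ 4) {D : Submodule ℝ L}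
    (hD : D = bracketSpan ⊤ ⊤) (hDtop : D ≠ ⊤) (hns : ¬ LieAlgebra.IsSolvable L) :
    bracketSpan D D = D := by
  by_contra hne
  have h1 : (LieAlgebra.derivedSeries ℝ L 1).toSubmodule = D := by
    rw [hD]; exact derivedSeries_succ_toSubmodule 0
  have h2 : (LieAlgebra.derivedSeries ℝ L 2).toSubmodule = bracketSpan D D := by
    rw [derivedSeries_succ_toSubmodule, h1]
  have hle : bracketSpan D D ≤ D := by
    rw [← h2, ← h1]
    exact LieAlgebra.derivedSeriesOfIdeal_succ_le ⊤ 1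
  have hlt := Submodule.finrank_lt_finrank_of_lt (lt_of_le_of_ne hle hne)
  have hlt' := Submodule.finrank_lt hDtop
  have h3 : (LieAlgebra.derivedSeries ℝ L 3).toSubmodule = ⊥ := by
    rw [derivedSeries_succ_toSubmodule]
    exact bracketSpan_self_eq_bot_of_finrank_le_two _ (by rw [h2, ← hD]; exact hle)
      (by rw [h2]; omega)
  exact hns (LieAlgebra.IsSolvable.mk ((LieSubmodule.toSubmodule_eq_bot _).1 h3))

/-- A derived algebra of codimension at most one satisfies `[L, [L, L]] = [L, L]`. -/
lemma bracketSpan_top_derived_of_codim_le_one {D : Submodule ℝ L} (hD : D = bracketSpan ⊤ ⊤)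
    (hcodim : finrank ℝ L ≤ finrank ℝ D + 1) : bracketSpan ⊤ D = D := by
  refine le_antisymm ((bracketSpan_mono le_rfl le_top).trans hD.ge) ?_
  nth_rewrite 1 [hD]
  exact bracketSpan_self_le_of_codim_le_one le_top (by rwa [finrank_top])

/-- If the derived algebra `D` satisfies `0 < [L, D] < D`, then `[L, D]` is a line, and the
brackets of a complement of `D` span a second line in `D`. -/
lemma exists_complement_with_bracket_line (hL : finrank ℝ L ≤ 4) {D V : Submodule ℝ L}
    (hD : D = bracketSpan ⊤ ⊤) (hV : V = bracketSpan ⊤ D) (hVbot : V ≠ ⊥) (hVD : V ≠ D) :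
    finrank ℝ V = 1 ∧ ∃ T : Submodule ℝ L, IsCompl T D ∧ T ≠ ⊥ ∧
      finrank ℝ (bracketSpan T T) = 1 ∧ Disjoint (bracketSpan T T) V ∧ bracketSpan T T ⊔ V = D := by
  have hle : V ≤ D := by rw [hV, hD]; exact bracketSpan_mono le_rfl le_top
  have h1 := Submodule.finrank_lt_finrank_of_lt (lt_of_le_of_ne hle hVD)
  have h2 : 1 ≤ finrank ℝ V := Submodule.one_le_finrank_iff.2 hVbot
  have h3 : ¬ finrank ℝ L ≤ finrank ℝ D + 1 := fun h =>
    hVD (hV.trans (bracketSpan_top_derived_of_codim_le_one hD h))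
  obtain ⟨T, hT⟩ := Submodule.exists_isCompl D
  have h4 := Submodule.finrank_add_eq_of_isCompl hT
  have h5 : finrank ℝ (bracketSpan T T) ≤ 1 := finrank_bracketSpan_self_le_one (by omega)
  have hsup : bracketSpan T T ⊔ V = D := by
    refine le_antisymm (sup_le ?_ hle) ?_
    · rw [hD]; exact bracketSpan_mono le_top le_top
    · calc D = bracketSpan (D ⊔ T) (D ⊔ T) := by rw [hT.sup_eq_top, hD]
        _ ≤ bracketSpan T T ⊔ V := by
          rw [bracketSpan_sup_left, bracketSpan_sup_right T, hV]
          refine sup_le ?_ (sup_le ?_ le_sup_left)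
          · rw [bracketSpan_comm D]
            exact (bracketSpan_mono le_top le_rfl).trans le_sup_right
          · exact (bracketSpan_mono le_top le_rfl).trans le_sup_right
  have h6 := Submodule.finrank_sup_add_finrank_inf_eq (bracketSpan T T) V
  rw [hsup] at h6
  refine ⟨by omega, T, hT.symm, ?_, by omega, ?_, hsup⟩
  · rintro rfl
    rw [finrank_bot] at h4
    omega
  · rw [disjoint_iff]
    exact Submodule.finrank_eq_zero.1 (by omega)

end Structure

/-! ### Saturated gradations with at most three components -/

section Gradations

open Module

variable {L : Type*} [LieRing L] [LieAlgebra ℝ L]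

/-- The graph of the gradation reflects the structure of the Lie algebra: solvability, the derived
series, nilpotency, the lower central series, ideals, simplicity and semisimplicity. -/
def MagmaGrading.ReflectsStructure {M : Type*} [CommMagma M] (𝒢 : MagmaGrading L M) : Prop :=
  (¬ LieAlgebra.IsSolvable L ↔
    ∃ W : 𝒢.graph.DirectedWalk, W.IsClosed ∧ W.induced.SelfContained) ∧
  (∀ ℓ : ℕ, sSup (𝒢.graph.derivedGraph ℓ).V =
    (LieAlgebra.derivedSeries ℝ L ℓ).toSubmodule) ∧
  (LieRing.IsNilpotent L ↔ ¬ ∃ W : 𝒢.graph.DirectedWalk, W.IsClosed) ∧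
  (∀ ℓ : ℕ, sSup (𝒢.graph.lowerCentralGraph ℓ).V =
    (LieModule.lowerCentralSeries ℝ L L ℓ).toSubmodule) ∧
  (∀ W : Set (Submodule ℝ L), 𝒢.graph.IdealGraphProperty W →
    ∃ I : LieIdeal ℝ L, I.toSubmodule = sSup W) ∧
  (LieAlgebra.IsSimple ℝ L →
    ∃ W : 𝒢.graph.DirectedWalk, W.IsClosed ∧ W.induced.V = 𝒢.graph.V) ∧
  (LieAlgebra.HasTrivialRadical ℝ L →
    ∀ v ∈ 𝒢.graph.V, ∃ W : 𝒢.graph.DirectedWalk,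
      W.IsClosed ∧ v ∈ W.induced.V ∧ W.induced.SelfContained)

/-- A saturated gradation reflects the structure of the algebra as soon as nonsolvability is
witnessed by an idempotent index with nonabelian component, and algebras with trivial radical get
only one component. -/
lemma MagmaGrading.IsSaturated.reflectsStructure [FiniteDimensional ℝ L] {M : Type*} [CommMagma M]
    {𝒢 : MagmaGrading L M} (h𝒢 : 𝒢.IsSaturated)
    (hns : ¬ LieAlgebra.IsSolvable L → ∃ j, j * j = j ∧ bracketSpan (𝒢.comp j) (𝒢.comp j) ≠ ⊥)
    (hss : LieAlgebra.HasTrivialRadical ℝ L → Subsingleton M) : 𝒢.ReflectsStructure := by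
  have : Finite M := WellFoundedGT.finite_of_iSupIndep 𝒢.independent 𝒢.comp_ne_bot
  have hloop : ¬ LieAlgebra.IsSolvable L → ∃ j, ∃ W : 𝒢.graph.DirectedWalk, W.IsClosed ∧
      W.induced.V = {𝒢.comp j} ∧ W.induced.SelfContained := by
    intro h
    obtain ⟨j, hjj, hj⟩ := hns h
    have he := 𝒢.edge_mem_graph hj
    rw [hjj] at he
    exact ⟨j, LabeledDigraph.loopWalk _ he rfl, LabeledDigraph.loopWalk_isClosed _ he rfl,
      LabeledDigraph.loopWalk_induced_V _ he rfl,
      LabeledDigraph.loopWalk_induced_selfContained _ he rfl rfl⟩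
  have hrad : LieAlgebra.HasTrivialRadical ℝ L → Nontrivial L → ¬ LieAlgebra.IsSolvable L := by
    intro h _ hsol
    have := h.radical_eq_bot
    rw [LieAlgebra.radical_eq_top_of_isSolvable] at this
    exact top_ne_bot this
  refine ⟨⟨fun h => ?_, ?_⟩, h𝒢.sSup_derivedGraph, h𝒢.isNilpotent_iff_not_exists_closed_walk,
    h𝒢.sSup_lowerCentralGraph, fun W hW => 𝒢.exists_lieIdeal_of_idealGraphProperty hW,
    fun h => ?_, ?_⟩
  · obtain ⟨j, W, hW, -, hself⟩ := hloop h
    exact ⟨W, hW, hself⟩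
  · rintro ⟨W, hW, hself⟩
    exact h𝒢.not_isSolvable_of_closed_walk hW hself
  · have := hss inferInstance
    obtain ⟨j, W, hW, hV, -⟩ := hloop (hrad inferInstance (LieAlgebra.IsSimple.nontrivial ℝ L))
    refine ⟨W, hW, hV.trans (Set.eq_of_subset_of_subset ?_ ?_)⟩
    · rintro _ rfl
      exact ⟨j, rfl⟩
    · rintro _ ⟨k, rfl⟩
      exact congrArg 𝒢.comp (Subsingleton.elim k j)
  · rintro h _ ⟨k, rfl⟩
    have := hss h
    obtain ⟨x, -, hx⟩ := (𝒢.comp k).exists_mem_ne_zero_of_ne_bot (𝒢.comp_ne_bot k)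
    obtain ⟨j, W, hW, hV, hself⟩ := hloop (hrad h ⟨x, 0, hx⟩)
    refine ⟨W, hW, ?_, hself⟩
    rw [hV, Subsingleton.elim k j]
    rfl

/-- The zero algebra is graded by the empty magma. -/
lemma exists_reflectsStructure_of_subsingleton [Subsingleton L] :
    ∃ (M : Type) (_ : CommMagma M) (𝒢 : MagmaGrading L M), 𝒢.ReflectsStructure := by
  let inst : CommMagma Empty := { mul := fun a _ => a, mul_comm := fun a => a.elim }
  refine ⟨Empty, inst,
    { comp := fun a => a.elim
      independent := fun a => a.elim
      iSup_eq_top := Subsingleton.elim _ _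
      comp_ne_bot := fun a => a.elim
      bracket_le := fun a => a.elim }, ?_⟩
  exact MagmaGrading.IsSaturated.reflectsStructure
    ⟨fun a => a.elim, fun a => a.elim, fun a => a.elim⟩
    (fun h => (h inferInstance).elim) fun _ => inferInstance

/-- A nonzero algebra that is abelian or perfect is graded with a single component. -/
lemma exists_reflectsStructure_of_abelian_or_perfect [FiniteDimensional ℝ L] [Nontrivial L]
    (h : bracketSpan (⊤ : Submodule ℝ L) ⊤ = ⊥ ∨ bracketSpan (⊤ : Submodule ℝ L) ⊤ = ⊤) :
    ∃ (M : Type) (_ : CommMagma M) (𝒢 : MagmaGrading L M), 𝒢.ReflectsStructure := by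
  have hsat : bracketSpan (⊤ : Submodule ℝ L) ⊤ ≠ ⊥ → ⊤ ≤ bracketSpan (⊤ : Submodule ℝ L) ⊤ :=
    fun hne => (h.resolve_left hne).ge
  refine ⟨Unit, inferInstance,
    { comp := fun _ => ⊤
      independent := fun i => by
        have : (⨆ (j : Unit) (_ : j ≠ i), (⊤ : Submodule ℝ L)) = ⊥ :=
          iSup₂_eq_bot.2 fun j hj => (hj (Subsingleton.elim j i)).elim
        rw [this]
        exact disjoint_bot_right
      iSup_eq_top := iSup_const
      comp_ne_bot := fun _ => top_ne_bot
      bracket_le := fun _ _ => le_top }, ?_⟩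
  refine MagmaGrading.IsSaturated.reflectsStructure
    ⟨fun _ _ => hsat, fun _ _ _ => hsat, fun _ _ _ _ => hsat⟩ (fun hns => ⟨(), rfl, fun hbot => ?_⟩)
    fun _ => inferInstance
  refine hns (LieAlgebra.IsSolvable.mk (R := ℝ) (k := 1) ?_)
  rw [← LieSubmodule.toSubmodule_eq_bot, derivedSeries_succ_toSubmodule]
  exact hbot

/-- Indices `t` for a complement of the derived algebra and `d` for the derived algebra; every
product is `d`. -/
inductive DerivedIndex
  | t
  | d

instance : CommMagma DerivedIndex where
  mul _ _ := .d
  mul_comm _ _ := rfl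

/-- If the derived algebra `D` is abelian or perfect, and `[L, D]` is `0` or `D`, then `L` is graded
by `D` and any complement of `D`. -/
lemma exists_reflectsStructure_of_derived [FiniteDimensional ℝ L] {D : Submodule ℝ L}
    (hD : D = bracketSpan ⊤ ⊤) (hbot : D ≠ ⊥) (htop : D ≠ ⊤)
    (hDD : bracketSpan D D = ⊥ ∨ bracketSpan D D = D)
    (hLD : bracketSpan ⊤ D = ⊥ ∨ bracketSpan ⊤ D = D)
    (hns : ¬ LieAlgebra.IsSolvable L → bracketSpan D D ≠ ⊥) :
    ∃ (M : Type) (_ : CommMagma M) (𝒢 : MagmaGrading L M), 𝒢.ReflectsStructure := by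
  obtain ⟨T, hT⟩ := Submodule.exists_isCompl D
  have hTbot : T ≠ ⊥ := by
    rintro rfl
    exact htop (by simpa using hT.sup_eq_top)
  let comp : DerivedIndex → Submodule ℝ L
    | .t => T
    | .d => D
  let 𝒢 : MagmaGrading L DerivedIndex :=
    { comp := comp
      independent := by
        rintro (_ | _)
        · refine hT.symm.disjoint.mono_right (iSup₂_le ?_)
          rintro (_ | _) h
          · exact (h rfl).elim
          · exact le_rfl
        · refine hT.disjoint.mono_right (iSup₂_le ?_)
          rintro (_ | _) h
          · exact le_rfl
          · exact (h rfl).elim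
      iSup_eq_top := by
        rw [eq_top_iff, ← hT.sup_eq_top]
        exact sup_le (le_iSup comp .d) (le_iSup comp .t)
      comp_ne_bot := by
        rintro (_ | _)
        · exact hTbot
        · exact hbot
      bracket_le := fun j k => (bracketSpan_mono le_top le_top).trans hD.ge }
  have hcomp : ∀ j, 𝒢.comp j ≤ bracketSpan ⊤ ⊤ → j = .d := by
    rintro (_ | _) h
    · refine (hTbot ?_).elim
      rw [← hD] at h
      exact disjoint_self.1 (hT.disjoint.mono_left h)
    · rfl
  refine ⟨DerivedIndex, inferInstance, 𝒢, MagmaGrading.IsSaturated.reflectsStructure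
    ⟨fun _ _ _ => hD.le, fun j k hj hne => ?_, fun j k hj hk hne => ?_⟩
    (fun h => ⟨.d, rfl, hns h⟩) fun h => ?_⟩
  · obtain rfl := hcomp j hj
    have hne' : bracketSpan ⊤ D ≠ ⊥ := by
      rw [bracketSpan_comm]
      exact fun h0 => hne (le_bot_iff.1 ((bracketSpan_mono le_rfl le_top).trans h0.le))
    rw [bracketSpan_comm]
    exact (hLD.resolve_left hne').ge
  · obtain rfl := hcomp j hj
    obtain rfl := hcomp k hk
    exact (hDD.resolve_left hne).ge
  · exact (htop (hD.trans bracketSpan_top_top_of_hasTrivialRadical)).elim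

lemma iSupIndep_of_three {ι : Type*} {comp : ι → Submodule ℝ L} (a b c : ι)
    (hι : ∀ i, i = a ∨ i = b ∨ i = c) (ha : Disjoint (comp a) (comp b ⊔ comp c))
    (hbc : Disjoint (comp b) (comp c)) : iSupIndep comp := by
  have hb : Disjoint (comp b) (comp c ⊔ comp a) :=
    hbc.disjoint_sup_right_of_disjoint_sup_left ha.symm
  have hc : Disjoint (comp c) (comp a ⊔ comp b) := by
    rw [sup_comm]
    exact hbc.symm.disjoint_sup_right_of_disjoint_sup_left (sup_comm (comp b) _ ▸ ha.symm)
  intro i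
  rcases hι i with rfl | rfl | rfl
  · refine ha.mono_right (iSup₂_le fun j hj => ?_)
    rcases hι j with rfl | rfl | rfl
    · exact (hj rfl).elim
    · exact le_sup_left
    · exact le_sup_right
  · refine hb.mono_right (iSup₂_le fun j hj => ?_)
    rcases hι j with rfl | rfl | rfl
    · exact le_sup_right
    · exact (hj rfl).elim
    · exact le_sup_left
  · refine hc.mono_right (iSup₂_le fun j hj => ?_)
    rcases hι j with rfl | rfl | rfl
    · exact le_sup_left
    · exact le_sup_right
    · exact (hj rfl).elim

/-- Indices `t` for a complement of the derived algebra `D`, `u` for its brackets with itself, and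
`v` for `[L, D]`; the products are `t * t = u` and `v` otherwise. -/
inductive FlagIndex
  | t
  | u
  | v

instance : CommMagma FlagIndex where
  mul
    | .t, .t => .u
    | _, _ => .v
  mul_comm := by rintro (_ | _ | _) (_ | _ | _) <;> rfl

/-- If the derived algebra `D` of a solvable `L` satisfies `0 < [L, D] < D`, then `L` is graded by a complement
`T` of `D`, the line `[T, T]` and the line `[L, D]`. -/
lemma exists_reflectsStructure_of_flag [FiniteDimensional ℝ L] (hL : finrank ℝ L ≤ 4)
    {D V : Submodule ℝ L} (hD : D = bracketSpan ⊤ ⊤) (htop : D ≠ ⊤)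
    (hV : V = bracketSpan ⊤ D) (hVbot : V ≠ ⊥) (hVD : V ≠ D) (hsol : LieAlgebra.IsSolvable L) :
    ∃ (M : Type) (_ : CommMagma M) (𝒢 : MagmaGrading L M), 𝒢.ReflectsStructure := by
  obtain ⟨hV1, T, hT, hTbot, hU1, hUV, hsup⟩ :=
    exists_complement_with_bracket_line hL hD hV hVbot hVD
  have hUD : bracketSpan T T ≤ D := hsup ▸ le_sup_left
  have hVD' : V ≤ D := hsup ▸ le_sup_right
  let comp : FlagIndex → Submodule ℝ L
    | .t => T
    | .u => bracketSpan T T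
    | .v => V
  -- A pair of indices other than `(t, t)` contains one whose component lies in `D`.
  have hbr : ∀ {A B : Submodule ℝ L}, B ≤ D → bracketSpan A B ≤ V := fun h =>
    (bracketSpan_mono le_top h).trans hV.ge
  have hbr' : ∀ {A B : Submodule ℝ L}, A ≤ D → bracketSpan A B ≤ V := fun h => by
    rw [bracketSpan_comm]
    exact hbr h
  let 𝒢 : MagmaGrading L FlagIndex :=
    { comp := comp
      independent := by
        refine iSupIndep_of_three .t .u .v ?_ ?_ hUV
        · rintro (_ | _ | _) <;> simp
        · change Disjoint T (bracketSpan T T ⊔ V)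
          rw [hsup]
          exact hT.disjoint
      iSup_eq_top := by
        rw [eq_top_iff, ← hT.sup_eq_top, ← hsup]
        exact sup_le (le_iSup comp .t) (sup_le (le_iSup comp .u) (le_iSup comp .v))
      comp_ne_bot := by
        rintro (_ | _ | _)
        · exact hTbot
        · exact Submodule.one_le_finrank_iff.1 hU1.ge
        · exact hVbot
      bracket_le := by
        rintro (_ | _ | _) (_ | _ | _)
        exacts [le_rfl, hbr hUD, hbr hVD', hbr' hUD, hbr hUD, hbr hVD', hbr' hVD', hbr hUD,
          hbr hVD'] }
  -- All products are indices of lines, so a nonzero bracket exhausts its target.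
  have hline : ∀ j k : FlagIndex, finrank ℝ (𝒢.comp (j * k)) = 1 := by
    rintro (_ | _ | _) (_ | _ | _)
    exacts [hU1, hV1, hV1, hV1, hV1, hV1, hV1, hV1, hV1]
  have hle : ∀ j k : FlagIndex, bracketSpan (𝒢.comp j) (𝒢.comp k) ≠ ⊥ →
      𝒢.comp (j * k) ≤ bracketSpan (𝒢.comp j) (𝒢.comp k) := fun j k h =>
    le_of_finrank_eq_one (hline j k) (𝒢.bracket_le j k) h
  refine ⟨FlagIndex, inferInstance, 𝒢, MagmaGrading.IsSaturated.reflectsStructure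
    ⟨fun j k h => (hle j k h).trans (bracketSpan_mono le_top le_top),
      fun j k _ h => (hle j k h).trans (bracketSpan_mono le_rfl le_top), fun j k _ _ => hle j k⟩
    (fun h => (h hsol).elim) fun h => ?_⟩
  exact (htop (hD.trans bracketSpan_top_top_of_hasTrivialRadical)).elim

/-- Indices for a Heisenberg algebra with centre `z`, its complement `p`, and a derivation `t`; the
products are `t * p = p * t = p` and `z` otherwise. -/
inductive HeisenbergIndex
  | t
  | p
  | z

instance : CommMagma HeisenbergIndex where
  mul
    | .t, .p => .p
    | .p, .t => .p
    | _, _ => .z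
  mul_comm := by rintro (_ | _ | _) (_ | _ | _) <;> rfl

/-- If the derived algebra is neither abelian nor perfect, it is a Heisenberg algebra, and `L` is
graded by a line, an invariant complement of the centre of the Heisenberg algebra, and the centre. -/
lemma exists_reflectsStructure_of_heisenberg [FiniteDimensional ℝ L] (hL : finrank ℝ L ≤ 4)
    {D : Submodule ℝ L} (hD : D = bracketSpan ⊤ ⊤) (htop : D ≠ ⊤) (hne : bracketSpan D D ≠ ⊥)
    (hnp : bracketSpan D D ≠ D) (hsol : LieAlgebra.IsSolvable L) :
    ∃ (M : Type) (_ : CommMagma M) (𝒢 : MagmaGrading L M), 𝒢.ReflectsStructure := by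
  obtain ⟨hL4, hD3, hE1⟩ := finrank_derived_derived hL hD htop hne hnp
  obtain ⟨E, hE⟩ : ∃ E, E = bracketSpan D D := ⟨_, rfl⟩
  rw [← hE] at hE1 hne
  obtain ⟨T, P, hT1, hPbot, hTD, hPE, hsup, hTP, hLE⟩ :=
    exists_invariant_complement hL4 hD hE hD3 hE1
  have hPD : P ≤ D := hsup ▸ le_sup_left
  let comp : HeisenbergIndex → Submodule ℝ L
    | .t => T
    | .p => P
    | .z => E
  have hbr : ∀ {A : Submodule ℝ L}, bracketSpan A E ≤ E := fun {_} =>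
    (bracketSpan_mono le_top le_rfl).trans hLE
  have hbr' : ∀ {A : Submodule ℝ L}, bracketSpan E A ≤ E := by
    intro A
    rw [bracketSpan_comm]
    exact hbr
  have hPT : bracketSpan P T = P := (bracketSpan_comm P T).trans hTP
  let 𝒢 : MagmaGrading L HeisenbergIndex :=
    { comp := comp
      independent := by
        refine iSupIndep_of_three .t .p .z ?_ ?_ hPE
        · rintro (_ | _ | _) <;> simp
        · change Disjoint T (P ⊔ E)
          rw [hsup]
          exact hTD.disjoint
      iSup_eq_top := by
        rw [eq_top_iff, ← hTD.sup_eq_top, ← hsup]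
        exact sup_le (le_iSup comp .t) (sup_le (le_iSup comp .p) (le_iSup comp .z))
      comp_ne_bot := by
        rintro (_ | _ | _)
        · exact Submodule.one_le_finrank_iff.1 hT1.ge
        · exact hPbot
        · exact hne
      bracket_le := by
        rintro (_ | _ | _) (_ | _ | _)
        exacts [(bracketSpan_self_eq_bot_of_finrank_le_one hT1.le).le.trans bot_le, hTP.le, hbr,
          hPT.le, (bracketSpan_mono hPD hPD).trans hE.ge, hbr, hbr', hbr', hbr] }
  -- A nonzero bracket exhausts its target: the target is the line `E`, or it is `P = [T, P]`.
  have hle : ∀ j k : HeisenbergIndex, bracketSpan (𝒢.comp j) (𝒢.comp k) ≠ ⊥ →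
      𝒢.comp (j * k) ≤ bracketSpan (𝒢.comp j) (𝒢.comp k) := by
    have hz : ∀ j k : HeisenbergIndex, j * k = .z → bracketSpan (𝒢.comp j) (𝒢.comp k) ≠ ⊥ →
        𝒢.comp (j * k) ≤ bracketSpan (𝒢.comp j) (𝒢.comp k) := fun j k hjk h =>
      le_of_finrank_eq_one (by rw [hjk]; exact hE1) (𝒢.bracket_le j k) h
    rintro (_ | _ | _) (_ | _ | _)
    exacts [hz _ _ rfl, fun _ => hTP.ge, hz _ _ rfl, fun _ => hPT.ge, hz _ _ rfl, hz _ _ rfl,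
      hz _ _ rfl, hz _ _ rfl, hz _ _ rfl]
  refine ⟨HeisenbergIndex, inferInstance, 𝒢, MagmaGrading.IsSaturated.reflectsStructure
    ⟨fun j k h => (hle j k h).trans (bracketSpan_mono le_top le_top),
      fun j k _ h => (hle j k h).trans (bracketSpan_mono le_rfl le_top), fun j k _ _ => hle j k⟩
    (fun h => (h hsol).elim) fun h => ?_⟩
  exact (htop (hD.trans bracketSpan_top_top_of_hasTrivialRadical)).elim

lemma exists_reflectsStructure [FiniteDimensional ℝ L] (hL : finrank ℝ L ≤ 4) :
    ∃ (M : Type) (_ : CommMagma M) (𝒢 : MagmaGrading L M), 𝒢.ReflectsStructure := by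
  rcases subsingleton_or_nontrivial L with hsub | hnt
  · exact exists_reflectsStructure_of_subsingleton
  obtain ⟨D, hD⟩ : ∃ D, D = bracketSpan (⊤ : Submodule ℝ L) ⊤ := ⟨_, rfl⟩
  by_cases hbot : D = ⊥
  · exact exists_reflectsStructure_of_abelian_or_perfect (Or.inl (hD.symm.trans hbot))
  by_cases htop : D = ⊤
  · exact exists_reflectsStructure_of_abelian_or_perfect (Or.inr (hD.symm.trans htop))
  have hns := bracketSpan_derived_of_not_isSolvable hL hD htop
  by_cases hDD : bracketSpan D D = D
  · refine exists_reflectsStructure_of_derived hD hbot htop (Or.inr hDD) (Or.inr ?_)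
      fun _ => by rwa [hDD]
    refine le_antisymm ((bracketSpan_mono le_rfl le_top).trans hD.ge) ?_
    nth_rewrite 1 [← hDD]
    exact bracketSpan_mono le_top le_rfl
  have hsol : LieAlgebra.IsSolvable L := by
    by_contra h
    exact hDD (hns h)
  by_cases hab : bracketSpan D D = ⊥
  · by_cases hV : bracketSpan ⊤ D = ⊥ ∨ bracketSpan ⊤ D = D
    · exact exists_reflectsStructure_of_derived hD hbot htop (Or.inl hab) hV
        fun h => (h hsol).elim
    · rw [not_or] at hV
      exact exists_reflectsStructure_of_flag hL hD htop rfl hV.1 hV.2 hsol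
  · exact exists_reflectsStructure_of_heisenberg hL hD htop hab hDD hsol

end Gradations

end LieGraph

theorem mainTheorem12 (L : Type*) [LieRing L] [LieAlgebra ℝ L] [FiniteDimensional ℝ L]
    (hdim : Module.finrank ℝ L ≤ 4) :
    ∃ (M : Type) (_ : CommMagma M) (𝒢 : LieGraph.MagmaGrading L M),
      -- solvability
      (¬ LieAlgebra.IsSolvable L ↔
        ∃ W : 𝒢.graph.DirectedWalk, W.IsClosed ∧ W.induced.SelfContained) ∧
      -- derived series
      (∀ ℓ : ℕ, sSup (𝒢.graph.derivedGraph ℓ).V =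
        (LieAlgebra.derivedSeries ℝ L ℓ).toSubmodule) ∧
      -- nilpotency
      (LieRing.IsNilpotent L ↔ ¬ ∃ W : 𝒢.graph.DirectedWalk, W.IsClosed) ∧
      -- lower central series
      (∀ ℓ : ℕ, sSup (𝒢.graph.lowerCentralGraph ℓ).V =
        (LieModule.lowerCentralSeries ℝ L L ℓ).toSubmodule) ∧
      -- ideals
      (∀ W : Set (Submodule ℝ L), 𝒢.graph.IdealGraphProperty W →
        ∃ I : LieIdeal ℝ L, I.toSubmodule = sSup W) ∧
      -- simplicity
      (LieAlgebra.IsSimple ℝ L →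
        ∃ W : 𝒢.graph.DirectedWalk, W.IsClosed ∧ W.induced.V = 𝒢.graph.V) ∧
      -- semisimplicity (trivial radical)
      (LieAlgebra.HasTrivialRadical ℝ L →
        ∀ v ∈ 𝒢.graph.V, ∃ W : 𝒢.graph.DirectedWalk,
          W.IsClosed ∧ v ∈ W.induced.V ∧ W.induced.SelfContained) :=
  LieGraph.exists_reflectsStructure hdim
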